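/- For probability measures $\mu,\nu$ on a measurable space and $0<q\le\infty$, let $\mathsf R_q(\mu\,\|\,\nu)\in[0,\infty]$ denote the Rényi divergence of order $q$: if $\mu\ll\nu$, then $$\mathsf R_q(\mu\,\|\,\nu)=\frac1{q-1}\log\int\Bigl(\frac{d\mu}{d\nu}\Bigr)^q d\nu\quad(q\neq1,\infty),\qquad \mathsf R_1(\mu\,\|\,\nu)=\mathsf{KL}(\mu\,\|\,\nu)=\int\frac{d\mu}{d\nu}\log\frac{d\mu}{d\nu}\,d\nu,\qquad \mathsf R_\infty(\mu\,\|\,\nu)=\log\Bigl\|\frac{d\mu}{d\nu}\Bigr\|_{L^\infty(\nu)};$$ if $\mu\not\ll\nu$, then $\mathsf R_q(\mu\,\|\,\nu)=+\infty$ for $q\ge1$, and $\mathsf R_q(\mu\,\|\,\nu)=\frac1{q-1}\log\int(\frac{d\mu}{d\lambda})^q(\frac{d\nu}{d\lambda})^{1-q}\,d\lambda$ with $\lambda=\mu+\nu$ for $q<1$ (where $\log 0=-\infty$). Let $W_\infty(\mu,\nu)=\inf_\gamma \operatorname{ess\,sup}_{(x,y)\sim\gamma}\|x-y\|\in[0,\infty]$,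 the infimum running over all couplings $\gamma$ of $\mu$ and $\nu$. Theorem. Let $0<q\le\infty$, and let $P$ be a Markov kernel on $\mathbb R^d$ such that the following two conditions hold. (a) There is $c>0$ such that $\mathsf R_q(\delta_xP\,\|\,\delta_yP)\le c\,\|x-y\|^2$ for all $x,y\in\mathbb R^d$. If $q<1$, assume moreover that there is $c'<\infty$ such that $\mathsf R_1(\delta_xP\,\|\,\delta_yP)\le c'\,\|x-y\|^2$ for all $x,y\in\mathbb R^d$. (b) There is $L>0$ such that $W_\infty(\mu P,\nu P)\le L\,W_\infty(\mu,\nu)$ for all Borel probability measures $\mu,\nu$ on $\mathbb R^d$. Then, for every integer $N\ge1$ and all $x,y\in\mathbb R^d$, $$\mathsf R_q(\delta_xP^N\,\|\,\delta_yP^N)\le c\,\frac{L^{-2}-1}{L^{-2N}-1}\,\|x-y\|^2,$$ where for $L=1$ the fraction is read as its limiting value $1/N$. -/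

import Mathlib

open MeasureTheory ProbabilityTheory
open scoped ENNReal

noncomputable section

/-- The Rényi divergence `R_q(μ ‖ ν)` of order `q ∈ (0, ∞]` between probability measures,
with values in the extended reals. For `q = 1` it is the Kullback-Leibler divergence, for `q = ∞`
the logarithm of the `ν`-essential supremum of `dμ/dν`. If `μ` is not absolutely continuous with
respect to `ν`, it is `+∞` for `q ≥ 1`, and for `q < 1` it is computed with the densities
with respect to the dominating measure `μ + ν`. (In the case `q < 1`, an integral equal to `0`
gives the value `(q - 1)⁻¹ * (-∞) = +∞`.) -/
def renyiDiv {α : Type*} [MeasurableSpace α] (q : ℝ≥0∞) (μ ν : Measure α) : EReal :=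
  open Classical in
  if q = 1 then (InformationTheory.klDiv μ ν : EReal)
  else if μ ≪ ν then
    if q = ∞ then ENNReal.log (essSup (μ.rnDeriv ν) ν)
    else (((q.toReal - 1)⁻¹ : ℝ) : EReal) *
      ENNReal.log (∫⁻ x, μ.rnDeriv ν x ^ q.toReal ∂ν)
  else if q < 1 then (((q.toReal - 1)⁻¹ : ℝ) : EReal) *
      ENNReal.log (∫⁻ x, μ.rnDeriv (μ + ν) x ^ q.toReal *
        ν.rnDeriv (μ + ν) x ^ (1 - q.toReal) ∂(μ + ν))
  else ⊤

/-- The set of couplings of `μ` and `ν`: the measures on the product with marginals `μ`, `ν`. -/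
def couplings {α : Type*} [MeasurableSpace α] (μ ν : Measure α) : Set (Measure (α × α)) :=
  {γ | γ.fst = μ ∧ γ.snd = ν}

/-- The `∞`-Wasserstein distance: the infimum over couplings of the essential supremum of the
distance. It may be `+∞`. -/
def wassersteinInfty {α : Type*} [MeasurableSpace α] [PseudoEMetricSpace α]
    (μ ν : Measure α) : ℝ≥0∞ :=
  ⨅ γ ∈ couplings μ ν, essSup (fun p : α × α => edist p.1 p.2) γ

/-- The factor `(L⁻² - 1) / (L^(-2N) - 1)`, read as its limit `1 / N` at `L = 1`. -/
def multiStepFactor (L : ℝ) (N : ℕ) : ℝ :=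
  open Classical in
  if L = 1 then 1 / (N : ℝ)
  else (L ^ (-2 : ℤ) - 1) / (L ^ (-2 * (N : ℤ)) - 1)

end

open InformationTheory

/-! The proof is a shifted composition argument. Beside the chains `μ P^k` and `ν P^k`, run an
auxiliary chain starting at `ν`: before each step its law is shifted a fraction `t` of the way
towards the first chain, and the last shift is complete, so it ends at `μ P^N`. By
`renyiDiv_bind_le`, a shift of length at most `r` followed by one step adds at most `c * r ^ 2` to
the divergence from `ν P^k`. That rests on the composition rule `renyiDiv_compProd_le` and data
processing `renyiDiv_map_le`. The composition rule needs an almost sure bound on the kernel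
divergences, hence `W_∞`. If the distance is `w`, the shift costs `c * (t * w) ^ 2` and leaves a
distance at most `L * (1 - t) * w` after the step. Optimizing `t` recursively gives the inverse
geometric sum in `renyiDiv_bind_pow_le`. An optimal coupling is never needed: strict bounds with
slack are propagated, and the slack tends to zero at the end. -/

/-- The Hellinger integral of order `r`: the integral of `(dμ/dν) ^ r` against `ν`. -/
noncomputable def hellingerIntegral {α : Type*} [MeasurableSpace α] (r : ℝ) (μ ν : Measure α) :
    ℝ≥0∞ :=
  ∫⁻ x, μ.rnDeriv ν x ^ r ∂ν

/-! ### Threshold forms of the Rényi divergence and data processing -/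

section Renyi

variable {α β : Type*} [MeasurableSpace α] [MeasurableSpace β]

lemma renyiDiv_one (μ ν : Measure α) : renyiDiv 1 μ ν = (klDiv μ ν : EReal) := by
  simp [renyiDiv]

lemma renyiDiv_one_le_iff {μ ν : Measure α} {B : ℝ} (hB : 0 ≤ B) :
    renyiDiv 1 μ ν ≤ (B : EReal) ↔ klDiv μ ν ≤ ENNReal.ofReal B := by
  rw [renyiDiv_one, ← EReal.coe_ennreal_le_coe_ennreal_iff, EReal.coe_ennreal_ofReal,
    max_eq_left hB]

lemma log_le_coe_iff {x : ℝ≥0∞} {B : ℝ} :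
    ENNReal.log x ≤ (B : EReal) ↔ x ≤ EReal.exp B := by
  rw [← ENNReal.log_le_log_iff, EReal.log_exp]

lemma renyiDiv_top_le_iff {μ ν : Measure α} (h : μ ≪ ν) {B : ℝ} :
    renyiDiv ∞ μ ν ≤ (B : EReal) ↔ essSup (μ.rnDeriv ν) ν ≤ EReal.exp B := by
  rw [← log_le_coe_iff]
  simp [renyiDiv, h]

lemma renyiDiv_le_iff_rpow {q : ℝ≥0∞} (hq1 : q ≠ 1) (hq : q ≠ ∞) {μ ν : Measure α} (h : μ ≪ ν)
    {B : ℝ} :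
    renyiDiv q μ ν ≤ (B : EReal) ↔
      hellingerIntegral q.toReal μ ν ^ (q.toReal - 1)⁻¹ ≤ EReal.exp B := by
  rw [← log_le_coe_iff, ENNReal.log_rpow]
  simp [renyiDiv, h, hq1, hq, hellingerIntegral]

lemma renyiDiv_le_iff_of_one_lt {q : ℝ≥0∞} (hq1 : 1 < q) (hq : q ≠ ∞) {μ ν : Measure α}
    (h : μ ≪ ν) {B : ℝ} :
    renyiDiv q μ ν ≤ (B : EReal) ↔
      hellingerIntegral q.toReal μ ν ≤ EReal.exp B ^ (q.toReal - 1) := by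
  have : 0 < q.toReal - 1 := by
    rw [sub_pos, ← ENNReal.toReal_one]
    exact (ENNReal.toReal_lt_toReal ENNReal.one_ne_top hq).2 hq1
  rw [renyiDiv_le_iff_rpow hq1.ne' hq h, ENNReal.rpow_inv_le_iff this]

/-- Since `q - 1 < 0`, the inequality reverses: for `q < 1` every later estimate bounds the
Hellinger integral from below. -/
lemma renyiDiv_le_iff_of_lt_one {q : ℝ≥0∞} (hq1 : q < 1) {μ ν : Measure α}
    (h : μ ≪ ν) {B : ℝ} :
    renyiDiv q μ ν ≤ (B : EReal) ↔
      EReal.exp B ^ (q.toReal - 1) ≤ hellingerIntegral q.toReal μ ν := by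
  have hq : q ≠ ∞ := ne_top_of_lt hq1
  have : 0 < 1 - q.toReal := by
    rw [sub_pos, ← ENNReal.toReal_one]
    exact (ENNReal.toReal_lt_toReal hq ENNReal.one_ne_top).2 hq1
  rw [renyiDiv_le_iff_rpow hq1.ne hq h, ← neg_sub 1 q.toReal, inv_neg, ENNReal.rpow_neg,
    ENNReal.rpow_neg, ENNReal.inv_le_iff_inv_le, ENNReal.le_rpow_inv_iff this, ENNReal.inv_rpow]

/-- A finite Rényi divergence of order at least one forces absolute continuity. -/
lemma absolutelyContinuous_of_renyiDiv_le {q : ℝ≥0∞} (hq : 1 ≤ q) {μ ν : Measure α} {B : ℝ}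
    (h : renyiDiv q μ ν ≤ (B : EReal)) : μ ≪ ν := by
  by_contra hac
  have : renyiDiv q μ ν = ⊤ := by
    by_cases h1 : q = 1
    · simp [h1, renyiDiv_one, klDiv_of_not_ac hac]
    · simp [renyiDiv, h1, hac, hq.not_gt]
  simp [this] at h

lemma hellingerIntegral_eq_lintegral_ofReal {r : ℝ} (hr : 0 ≤ r) (μ ν : Measure α)
    [SigmaFinite μ] :
    hellingerIntegral r μ ν = ∫⁻ x, ENNReal.ofReal ((μ.rnDeriv ν x).toReal ^ r) ∂ν := by
  refine lintegral_congr_ae ?_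
  filter_upwards [μ.rnDeriv_ne_top ν] with x hx
  rw [ENNReal.toReal_rpow, ENNReal.ofReal_toReal (ENNReal.rpow_ne_top_of_nonneg hr hx)]

/-- Data processing inequality for the integral of a convex function of the density. -/
lemma ConvexOn.integral_comp_rnDeriv_map_le {μ ν : Measure α} [IsFiniteMeasure μ]
    [IsFiniteMeasure ν] {f : ℝ → ℝ} {g : α → β} (hμν : μ ≪ ν) (hg : Measurable g)
    (hf : StronglyMeasurable f) (hf_cvx : ConvexOn ℝ (Set.Ici 0) f)
    (hf_cont_at : ContinuousWithinAt f (Set.Ici 0) 0)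
    (h_int : Integrable (fun x ↦ f (μ.rnDeriv ν x).toReal) ν) :
    ∫ x, f ((μ.map g).rnDeriv (ν.map g) x).toReal ∂(ν.map g) ≤
      ∫ x, f (μ.rnDeriv ν x).toReal ∂ν := by
  have hm := hf_cvx.integrable_comp_rnDeriv_map hμν hg hf hf_cont_at h_int
  rw [← integral_condExp hg.comap_le, integral_map hg.aemeasurable hm.aestronglyMeasurable]
  exact integral_mono_ae (hm.comp_measurable hg) integrable_condExp
    (hf_cvx.comp_rnDeriv_map_le hμν hg hf hf_cont_at h_int)

lemma hellingerIntegral_map_le {μ ν : Measure α} [IsFiniteMeasure μ]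
    [IsFiniteMeasure ν] {g : α → β} (hμν : μ ≪ ν) (hg : Measurable g) {r : ℝ} (hr : 1 ≤ r) :
    hellingerIntegral r (μ.map g) (ν.map g) ≤ hellingerIntegral r μ ν := by
  have hr0 : 0 ≤ r := zero_le_one.trans hr
  by_cases htop : hellingerIntegral r μ ν = ∞
  · simp [htop]
  have hcont : Continuous fun x : ℝ ↦ x ^ r := Real.continuous_rpow_const hr0
  rw [hellingerIntegral_eq_lintegral_ofReal hr0] at htop ⊢
  rw [hellingerIntegral_eq_lintegral_ofReal hr0]
  have h_int : Integrable (fun x ↦ (fun x : ℝ ↦ x ^ r) (μ.rnDeriv ν x).toReal) ν := by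
    refine (lintegral_ofReal_ne_top_iff_integrable ?_ ?_).1 htop
    · exact (hcont.measurable.comp (by fun_prop)).aestronglyMeasurable
    · exact ae_of_all _ fun x ↦ by positivity
  have h_int' := (convexOn_rpow hr).integrable_comp_rnDeriv_map hμν hg hcont.stronglyMeasurable
    hcont.continuousWithinAt h_int
  rw [← ofReal_integral_eq_lintegral_ofReal h_int (ae_of_all _ fun x ↦ by positivity),
    ← ofReal_integral_eq_lintegral_ofReal h_int' (ae_of_all _ fun x ↦ by positivity)]
  exact ENNReal.ofReal_le_ofReal ((convexOn_rpow hr).integral_comp_rnDeriv_map_le hμν hg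
    hcont.stronglyMeasurable hcont.continuousWithinAt h_int)

lemma le_hellingerIntegral_map {μ ν : Measure α} [IsFiniteMeasure μ]
    [IsFiniteMeasure ν] {g : α → β} (hμν : μ ≪ ν) (hg : Measurable g) {r : ℝ} (hr0 : 0 ≤ r)
    (hr : r ≤ 1) :
    hellingerIntegral r μ ν ≤ hellingerIntegral r (μ.map g) (ν.map g) := by
  have hcont : Continuous fun x : ℝ ↦ x ^ r := Real.continuous_rpow_const hr0
  rw [hellingerIntegral_eq_lintegral_ofReal hr0, hellingerIntegral_eq_lintegral_ofReal hr0]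
  have h_int : Integrable (fun x ↦ (fun x : ℝ ↦ x ^ r) (μ.rnDeriv ν x).toReal) ν := by
    -- For `0 ≤ r ≤ 1`, `x ^ r ≤ 1 + x` makes integrability automatic.
    refine Integrable.mono' (g := fun x ↦ 1 + (μ.rnDeriv ν x).toReal)
      ((integrable_const _).add Measure.integrable_toReal_rnDeriv)
      (hcont.measurable.comp (by fun_prop)).aestronglyMeasurable (ae_of_all _ fun x ↦ ?_)
    have h0 : 0 ≤ (μ.rnDeriv ν x).toReal := ENNReal.toReal_nonneg
    rw [Real.norm_of_nonneg (by positivity)]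
    rcases le_total (μ.rnDeriv ν x).toReal 1 with h | h
    · exact (Real.rpow_le_one h0 h hr0).trans (by linarith)
    · exact (Real.rpow_le_self_of_one_le h hr).trans (by linarith)
  have hcvx := (Real.concaveOn_rpow hr0 hr).neg
  have h_int' := hcvx.integrable_comp_rnDeriv_map hμν hg hcont.neg.stronglyMeasurable
    hcont.neg.continuousWithinAt h_int.neg
  have key := hcvx.integral_comp_rnDeriv_map_le hμν hg hcont.neg.stronglyMeasurable
    hcont.neg.continuousWithinAt h_int.neg
  have h_int'' : Integrable (fun x ↦ ((μ.map g).rnDeriv (ν.map g) x).toReal ^ r) (ν.map g) := by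
    simpa using h_int'.neg
  rw [← ofReal_integral_eq_lintegral_ofReal h_int (ae_of_all _ fun x ↦ by positivity),
    ← ofReal_integral_eq_lintegral_ofReal h_int'' (ae_of_all _ fun x ↦ by positivity)]
  refine ENNReal.ofReal_le_ofReal ?_
  simpa [integral_neg] using key

/-- Recasts order `∞` as domination of measures, which passes to images and composition products
without computing densities. -/
lemma essSup_rnDeriv_le_iff {μ ν : Measure α} [IsFiniteMeasure μ] [IsFiniteMeasure ν]
    (h : μ ≪ ν) {M : ℝ≥0∞} :
    essSup (μ.rnDeriv ν) ν ≤ M ↔ μ ≤ M • ν := by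
  constructor
  · intro hle
    refine Measure.le_iff.2 fun s hs ↦ ?_
    rw [← Measure.setLIntegral_rnDeriv h, Measure.smul_apply, smul_eq_mul,
      ← setLIntegral_const]
    refine lintegral_mono_ae (ae_restrict_of_ae ?_)
    filter_upwards [ENNReal.ae_le_essSup (μ := ν) (μ.rnDeriv ν)] with x hx using hx.trans hle
  · intro hle
    refine essSup_le_of_ae_le _ ?_
    refine ae_le_of_forall_setLIntegral_le_of_sigmaFinite (by fun_prop) fun s hs _ ↦ ?_
    rw [setLIntegral_const]
    exact (Measure.setLIntegral_rnDeriv_le s).trans (by simpa using hle s)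

/-- Data processing inequality for the Rényi divergence. -/
theorem renyiDiv_map_le {q : ℝ≥0∞} (hq : 0 < q) {μ ν : Measure α} [IsProbabilityMeasure μ]
    [IsProbabilityMeasure ν] (hμν : μ ≪ ν) {g : α → β} (hg : Measurable g) {B : ℝ}
    (h : renyiDiv q μ ν ≤ (B : EReal)) :
    renyiDiv q (μ.map g) (ν.map g) ≤ (B : EReal) := by
  have hac := hμν.map hg
  rcases lt_trichotomy q 1 with h1 | rfl | h1
  · rw [renyiDiv_le_iff_of_lt_one h1 hμν] at h
    rw [renyiDiv_le_iff_of_lt_one h1 hac]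
    refine h.trans (le_hellingerIntegral_map hμν hg ENNReal.toReal_nonneg ?_)
    simpa using ENNReal.toReal_mono ENNReal.one_ne_top h1.le
  · rw [renyiDiv_one] at h ⊢
    exact le_trans (EReal.coe_ennreal_le_coe_ennreal_iff.2 (klDiv_map_le μ ν hg)) h
  · by_cases htop : q = ∞
    · subst htop
      rw [renyiDiv_top_le_iff hμν, essSup_rnDeriv_le_iff hμν] at h
      rw [renyiDiv_top_le_iff hac, essSup_rnDeriv_le_iff hac,
        ← Measure.map_smul]
      exact Measure.map_mono h hg
    · rw [renyiDiv_le_iff_of_one_lt h1 htop hμν] at h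
      rw [renyiDiv_le_iff_of_one_lt h1 htop hac]
      refine (hellingerIntegral_map_le hμν hg ?_).trans h
      simpa using ENNReal.toReal_mono htop h1.le

end Renyi

/-! ### Densities and chain rules for composition products -/

section CompProd

variable {α β : Type*} [MeasurableSpace α] [MeasurableSpace β]
  [MeasurableSpace.CountableOrCountablyGenerated α β]
  {μ ν : Measure α} [IsFiniteMeasure μ] [IsFiniteMeasure ν]
  {κ η : Kernel α β} [IsFiniteKernel κ] [IsFiniteKernel η]

lemma compProd_eq_withDensity (hμν : μ ≪ ν) (hκη : ∀ a, κ a ≪ η a) :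
    μ ⊗ₘ κ = (ν ⊗ₘ η).withDensity fun p ↦ μ.rnDeriv ν p.1 * κ.rnDeriv η p.1 p.2 := by
  have hmeas : Measurable fun p : α × β ↦ μ.rnDeriv ν p.1 * κ.rnDeriv η p.1 p.2 := by fun_prop
  ext s hs
  rw [withDensity_apply _ hs, ← lintegral_indicator hs,
    Measure.lintegral_compProd (hmeas.indicator hs), Measure.compProd_apply hs,
    ← lintegral_rnDeriv_mul hμν (Kernel.measurable_kernel_prodMk_left hs).aemeasurable]
  refine lintegral_congr fun a ↦ ?_
  have hs' : MeasurableSet (Prod.mk a ⁻¹' s) := measurable_prodMk_left hs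
  rw [← Measure.setLIntegral_rnDeriv (hκη a),
    setLIntegral_congr_fun_ae hs' (g := κ.rnDeriv η a)
      (κ.rnDeriv_eq_rnDeriv_measure.mono fun x hx _ ↦ hx.symm),
    ← lintegral_indicator hs', ← lintegral_const_mul _ ((by fun_prop : Measurable _).indicator hs')]
  refine lintegral_congr fun b ↦ ?_
  by_cases hb : (a, b) ∈ s <;> simp [Set.indicator, hb]

lemma rnDeriv_compProd_eq_mul (hμν : μ ≪ ν) (hκη : ∀ a, κ a ≪ η a) :
    (μ ⊗ₘ κ).rnDeriv (ν ⊗ₘ η) =ᵐ[ν ⊗ₘ η]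
      fun p ↦ μ.rnDeriv ν p.1 * κ.rnDeriv η p.1 p.2 := by
  rw [compProd_eq_withDensity hμν hκη]
  exact Measure.rnDeriv_withDensity _ (by fun_prop)

lemma hellingerIntegral_kernel (r : ℝ) (a : α) :
    hellingerIntegral r (κ a) (η a) = ∫⁻ b, κ.rnDeriv η a b ^ r ∂(η a) :=
  lintegral_congr_ae (κ.rnDeriv_eq_rnDeriv_measure.mono fun x hx ↦ by simp only [hx])

/-- Chain rule for the Hellinger integral. -/
lemma hellingerIntegral_compProd (hμν : μ ≪ ν) (hκη : ∀ a, κ a ≪ η a) {r : ℝ} (hr : 0 ≤ r) :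
    hellingerIntegral r (μ ⊗ₘ κ) (ν ⊗ₘ η) =
      ∫⁻ a, μ.rnDeriv ν a ^ r * hellingerIntegral r (κ a) (η a) ∂ν := by
  have : hellingerIntegral r (μ ⊗ₘ κ) (ν ⊗ₘ η) =
      ∫⁻ p, (μ.rnDeriv ν p.1 * κ.rnDeriv η p.1 p.2) ^ r ∂(ν ⊗ₘ η) :=
    lintegral_congr_ae ((rnDeriv_compProd_eq_mul hμν hκη).mono fun x hx ↦ by simp only [hx])
  rw [this, Measure.lintegral_compProd (by fun_prop)]
  refine lintegral_congr fun a ↦ ?_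
  simp_rw [ENNReal.mul_rpow_of_nonneg _ _ hr]
  rw [lintegral_const_mul _ (by fun_prop), hellingerIntegral_kernel]

lemma klDiv_compProd_right_eq_lintegral (hκη : ∀ a, κ a ≪ η a) :
    klDiv (μ ⊗ₘ κ) (μ ⊗ₘ η) = ∫⁻ a, klDiv (κ a) (η a) ∂μ := by
  have hac : μ ⊗ₘ κ ≪ μ ⊗ₘ η := Measure.AbsolutelyContinuous.compProd_right (ae_of_all _ hκη)
  have h1 : (μ ⊗ₘ κ).rnDeriv (μ ⊗ₘ η) =ᵐ[μ ⊗ₘ η] fun p ↦ κ.rnDeriv η p.1 p.2 := by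
    have h2 : ∀ᵐ p ∂(μ ⊗ₘ η), μ.rnDeriv μ p.1 = 1 :=
      Measure.ae_eq_compProd_of_ae_eq_fst η (by fun_prop) (by fun_prop) μ.rnDeriv_self
    filter_upwards [rnDeriv_compProd_eq_mul Measure.AbsolutelyContinuous.rfl hκη, h2] with p hp hp'
    rw [hp, hp', one_mul]
  have h3 : klDiv (μ ⊗ₘ κ) (μ ⊗ₘ η) =
      ∫⁻ p, ENNReal.ofReal (klFun (κ.rnDeriv η p.1 p.2).toReal) ∂(μ ⊗ₘ η) := by
    rw [klDiv_eq_lintegral_klFun_of_ac hac]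
    exact lintegral_congr_ae (h1.mono fun x hx ↦ by simp only [hx])
  rw [h3, Measure.lintegral_compProd (by fun_prop)]
  refine lintegral_congr fun a ↦ ?_
  rw [klDiv_eq_lintegral_klFun_of_ac (hκη a)]
  exact lintegral_congr_ae (κ.rnDeriv_eq_rnDeriv_measure.mono fun x hx ↦ by simp only [hx])

end CompProd

/-! ### The composition rule -/

section RenyiCompProd

variable {α β : Type*} [MeasurableSpace α] [MeasurableSpace β]
  [MeasurableSpace.CountableOrCountablyGenerated α β]
  {μ ν : Measure α} [IsProbabilityMeasure μ] [IsProbabilityMeasure ν]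
  {κ η : Kernel α β} [IsMarkovKernel κ] [IsMarkovKernel η]

/-- Kernel bounds hold `μ`-a.e., while Hellinger integrals are taken against `ν`; where the density
vanishes, the integrand does too for positive order. -/
lemma ae_rnDeriv_ne_zero_imp {p : α → Prop} (hμν : μ ≪ ν) (h : ∀ᵐ a ∂μ, p a) :
    ∀ᵐ a ∂ν, μ.rnDeriv ν a ≠ 0 → p a := by
  rw [← Measure.withDensity_rnDeriv_eq μ ν hμν] at h
  exact (ae_withDensity_iff (by fun_prop)).1 h

lemma nonneg_of_renyiDiv_one_le {μ ν : Measure α} {B : ℝ} (h : renyiDiv 1 μ ν ≤ (B : EReal)) :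
    0 ≤ B := by
  rw [renyiDiv_one] at h
  exact_mod_cast (EReal.coe_ennreal_nonneg _).trans h

/-- Composition rule for the Rényi divergence. -/
theorem renyiDiv_compProd_le {q : ℝ≥0∞} (hq : 0 < q) (hμν : μ ≪ ν) (hκη : ∀ a, κ a ≪ η a)
    {B C : ℝ} (hB : renyiDiv q μ ν ≤ (B : EReal))
    (hC : ∀ᵐ a ∂μ, renyiDiv q (κ a) (η a) ≤ (C : EReal)) :
    renyiDiv q (μ ⊗ₘ κ) (ν ⊗ₘ η) ≤ ((B + C : ℝ) : EReal) := by
  have hac : μ ⊗ₘ κ ≪ ν ⊗ₘ η := hμν.compProd (ae_of_all _ hκη)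
  have hadd : EReal.exp ((B + C : ℝ) : EReal) = EReal.exp C * EReal.exp B := by
    rw [EReal.coe_add, EReal.exp_add, mul_comm]
  have hr : q ≠ ∞ → 0 < q.toReal := fun h ↦ ENNReal.toReal_pos hq.ne' h
  have hC' := ae_rnDeriv_ne_zero_imp hμν hC
  have hmeas : Measurable fun a ↦ μ.rnDeriv ν a ^ q.toReal := by fun_prop
  rcases lt_trichotomy q 1 with h1 | rfl | h1
  · have hr := hr (ne_top_of_lt h1)
    rw [renyiDiv_le_iff_of_lt_one h1 hμν] at hB
    rw [renyiDiv_le_iff_of_lt_one h1 hac, hellingerIntegral_compProd hμν hκη hr.le, hadd,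
      ENNReal.mul_rpow_of_ne_top (by simp) (by simp)]
    refine (mul_le_mul_right hB _).trans ?_
    rw [hellingerIntegral, ← lintegral_const_mul _ hmeas]
    refine lintegral_mono_ae ?_
    filter_upwards [hC'] with a ha
    by_cases h0 : μ.rnDeriv ν a = 0
    · simp [h0, hr]
    · rw [mul_comm]
      exact mul_le_mul_right ((renyiDiv_le_iff_of_lt_one h1 (hκη a)).1 (ha h0)) _
  · have hC0 : 0 ≤ C := by
      obtain ⟨a, ha⟩ := hC.exists
      exact nonneg_of_renyiDiv_one_le ha
    have hB0 := nonneg_of_renyiDiv_one_le hB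
    rw [renyiDiv_one_le_iff hB0] at hB
    rw [renyiDiv_one_le_iff (by positivity), klDiv_compProd_eq_add,
      klDiv_compProd_right_eq_lintegral hκη, ENNReal.ofReal_add hB0 hC0]
    gcongr
    calc ∫⁻ a, klDiv (κ a) (η a) ∂μ ≤ ∫⁻ _, ENNReal.ofReal C ∂μ :=
          lintegral_mono_ae (hC.mono fun a ha ↦ (renyiDiv_one_le_iff hC0).1 ha)
      _ = ENNReal.ofReal C := by simp
  · by_cases htop : q = ∞
    · subst htop
      rw [renyiDiv_top_le_iff hμν, essSup_rnDeriv_le_iff hμν] at hB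
      rw [renyiDiv_top_le_iff hac, essSup_rnDeriv_le_iff hac, hadd]
      refine Measure.le_iff.2 fun s hs ↦ ?_
      rw [Measure.smul_apply, smul_eq_mul, Measure.compProd_apply hs, Measure.compProd_apply hs]
      calc ∫⁻ a, κ a (Prod.mk a ⁻¹' s) ∂μ
          ≤ ∫⁻ a, EReal.exp C * η a (Prod.mk a ⁻¹' s) ∂μ := by
            refine lintegral_mono_ae (hC.mono fun a ha ↦ ?_)
            rw [renyiDiv_top_le_iff (hκη a), essSup_rnDeriv_le_iff (hκη a)] at ha
            simpa using ha (Prod.mk a ⁻¹' s)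
        _ = EReal.exp C * ∫⁻ a, η a (Prod.mk a ⁻¹' s) ∂μ :=
            lintegral_const_mul _ (Kernel.measurable_kernel_prodMk_left hs)
        _ ≤ EReal.exp C * ∫⁻ a, η a (Prod.mk a ⁻¹' s) ∂(EReal.exp (B : EReal) • ν) := by
            gcongr
        _ = _ := by rw [lintegral_smul_measure, smul_eq_mul, mul_assoc]
    · have hr := hr htop
      rw [renyiDiv_le_iff_of_one_lt h1 htop hμν] at hB
      rw [renyiDiv_le_iff_of_one_lt h1 htop hac, hellingerIntegral_compProd hμν hκη hr.le, hadd,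
        ENNReal.mul_rpow_of_ne_top (by simp) (by simp)]
      refine le_trans ?_ (mul_le_mul_right hB _)
      rw [hellingerIntegral, ← lintegral_const_mul _ hmeas]
      refine lintegral_mono_ae ?_
      filter_upwards [hC'] with a ha
      by_cases h0 : μ.rnDeriv ν a = 0
      · simp [h0, hr]
      · rw [mul_comm]
        exact mul_le_mul_left ((renyiDiv_le_iff_of_one_lt h1 htop (hκη a)).1 (ha h0)) _

lemma renyiDiv_self_le_zero (q : ℝ≥0∞) (μ : Measure α) [IsProbabilityMeasure μ] :
    renyiDiv q μ μ ≤ ((0 : ℝ) : EReal) := by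
  by_cases h1 : q = 1
  · simp [h1, renyiDiv_one]
  by_cases htop : q = ∞
  · subst htop
    rw [renyiDiv_top_le_iff .rfl, essSup_rnDeriv_le_iff .rfl]
    simp
  · rw [renyiDiv_le_iff_rpow h1 htop .rfl]
    have : hellingerIntegral q.toReal μ μ = ∫⁻ _, 1 ∂μ :=
      lintegral_congr_ae (μ.rnDeriv_self.mono fun x hx ↦ by simp [hx])
    simp [this]

end RenyiCompProd

/-! ### Shifted composition and interpolation in `W_∞` -/

section Shifted

lemma absolutelyContinuous_bind {α β : Type*} [MeasurableSpace α] [MeasurableSpace β]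
    {P : Kernel α β} (hP : ∀ x y, P x ≪ P y) (μ ν : Measure α) [NeZero ν] :
    μ.bind P ≪ ν.bind P := by
  refine Measure.AbsolutelyContinuous.mk fun s hs h ↦ ?_
  rw [Measure.bind_apply hs P.measurable.aemeasurable,
    lintegral_eq_zero_iff (P.measurable_coe hs)] at h
  obtain ⟨y, hy⟩ := h.exists
  rw [Measure.bind_apply hs P.measurable.aemeasurable]
  simp [fun x ↦ hP x y hy]

/-- Shifted composition rule: replacing the law `γ.fst` of the starting point by the coupled law
`γ.snd` costs at most the divergence between the kernel at coupled points. -/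
theorem renyiDiv_bind_le {E F : Type*} [MeasurableSpace E] [StandardBorelSpace E] [Nonempty E]
    [MeasurableSpace F] [MeasurableSpace.CountablyGenerated F]
    {q : ℝ≥0∞} (hq : 0 < q) {P : Kernel E F} [IsMarkovKernel P] (hP : ∀ x y, P x ≪ P y)
    {γ : Measure (E × E)} [IsProbabilityMeasure γ] {ν : Measure E} [IsProbabilityMeasure ν]
    (hγν : γ.fst ≪ ν) {B C : ℝ} (hB : renyiDiv q γ.fst ν ≤ (B : EReal))
    (hC : ∀ᵐ p ∂γ, renyiDiv q (P p.2) (P p.1) ≤ (C : EReal)) :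
    renyiDiv q (γ.snd.bind P) (ν.bind P) ≤ ((B + C : ℝ) : EReal) := by
  -- Drawing the shifted point from the same conditional law under `ν` makes `γ` against `ρ` cost no
  -- more than the bound `B` for the first marginals.
  set ρ : Measure (E × E) := ν ⊗ₘ γ.condKernel with hρ
  have hγ : γ.fst ⊗ₘ γ.condKernel = γ := γ.disintegrate γ.condKernel
  have hγρ : γ ≪ ρ := by
    rw [← hγ]
    exact hγν.compProd_left _
  have hB' : renyiDiv q γ ρ ≤ (B : EReal) := by
    have := renyiDiv_compProd_le (κ := γ.condKernel) (η := γ.condKernel) hq hγν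
      (fun _ ↦ .rfl) hB (ae_of_all _ fun a ↦ renyiDiv_self_le_zero q _)
    rwa [hγ, add_zero] at this
  -- Step from the shifted point under `γ`, but from the original point under `ρ`; the final
  -- marginals are then the two laws to compare.
  let κ : Kernel (E × E) F := P.comap Prod.snd measurable_snd
  let η : Kernel (E × E) F := P.comap Prod.fst measurable_fst
  have hac : ∀ p, κ p ≪ η p := fun p ↦ hP _ _
  have key := renyiDiv_map_le hq (hγρ.compProd (ae_of_all _ hac)) measurable_snd
    (renyiDiv_compProd_le hq hγρ hac hB' hC)
  have h1 : (γ ⊗ₘ κ).map Prod.snd = γ.snd.bind P := by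
    change (γ ⊗ₘ κ).snd = _
    rw [Measure.snd_compProd, show κ = P.comap Prod.snd measurable_snd from rfl, ← Kernel.comp_deterministic_eq_comap, ← Measure.comp_assoc,
      Measure.deterministic_comp_eq_map]
    rfl
  have h2 : (ρ ⊗ₘ η).map Prod.snd = ν.bind P := by
    change (ρ ⊗ₘ η).snd = _
    rw [Measure.snd_compProd, show η = P.comap Prod.fst measurable_fst from rfl, ← Kernel.comp_deterministic_eq_comap, ← Measure.comp_assoc,
      Measure.deterministic_comp_eq_map]
    change (ρ.fst).bind P = _
    rw [hρ, Measure.fst_compProd]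
  rwa [h1, h2] at key

lemma isProbabilityMeasure_of_mem_couplings {α : Type*} [MeasurableSpace α] {μ ν : Measure α}
    [IsProbabilityMeasure μ] {γ : Measure (α × α)} (hγ : γ ∈ couplings μ ν) :
    IsProbabilityMeasure γ :=
  ⟨by rw [← Measure.fst_univ, hγ.1, measure_univ]⟩

lemma exists_coupling_of_wassersteinInfty_lt {α : Type*} [MeasurableSpace α]
    [PseudoEMetricSpace α] {μ ν : Measure α} {w : ℝ≥0∞} (h : wassersteinInfty μ ν < w) :
    ∃ γ ∈ couplings μ ν, ∀ᵐ p ∂γ, edist p.1 p.2 ≤ w := by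
  simp only [wassersteinInfty, iInf_lt_iff] at h
  obtain ⟨γ, hγ, hw⟩ := h
  exact ⟨γ, hγ, (ENNReal.ae_le_essSup _).mono fun p hp ↦ hp.trans hw.le⟩

lemma wassersteinInfty_le_of_coupling {α : Type*} [MeasurableSpace α]
    [PseudoEMetricSpace α] {μ ν : Measure α} {γ : Measure (α × α)} (hγ : γ ∈ couplings μ ν)
    {w : ℝ≥0∞} (h : ∀ᵐ p ∂γ, edist p.1 p.2 ≤ w) : wassersteinInfty μ ν ≤ w :=
  (iInf₂_le γ hγ).trans (essSup_le_of_ae_le _ h)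

lemma wassersteinInfty_dirac_le {α : Type*} [MeasurableSpace α] [MeasurableSingletonClass α]
    [PseudoEMetricSpace α] (x y : α) :
    wassersteinInfty (Measure.dirac x) (Measure.dirac y) ≤ edist x y := by
  refine wassersteinInfty_le_of_coupling (γ := Measure.dirac (x, y)) ⟨?_, ?_⟩ ?_
  · simp [Measure.fst, Measure.map_dirac' measurable_fst]
  · simp [Measure.snd, Measure.map_dirac' measurable_snd]
  · simp [ae_dirac_eq]

variable {E : Type*} [NormedAddCommGroup E] [NormedSpace ℝ E] [MeasurableSpace E] [BorelSpace E]
  [SecondCountableTopology E]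

/-- Moving a fraction `t` of the way from `μ'` to `μ` along a near-optimal coupling. -/
lemma exists_interpolating_coupling {μ μ' : Measure E} [IsProbabilityMeasure μ] {w t : ℝ}
    (hw : wassersteinInfty μ μ' < ENNReal.ofReal w) (ht0 : 0 ≤ t) (ht1 : t ≤ 1) :
    ∃ γ : Measure (E × E), IsProbabilityMeasure γ ∧ γ.fst = μ' ∧
      (∀ᵐ p ∂γ, ‖p.2 - p.1‖ ≤ t * w) ∧
      wassersteinInfty μ γ.snd ≤ ENNReal.ofReal ((1 - t) * w) := by
  have hw0 : 0 < w := ENNReal.ofReal_pos.1 (bot_le.trans_lt hw)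
  obtain ⟨π, hπ, hdist⟩ := exists_coupling_of_wassersteinInfty_lt hw
  have := isProbabilityMeasure_of_mem_couplings hπ
  have hnorm : ∀ᵐ p ∂π, ‖p.1 - p.2‖ ≤ w := by
    filter_upwards [hdist] with p hp
    rwa [edist_dist, ENNReal.ofReal_le_ofReal_iff hw0.le, dist_eq_norm] at hp
  let z : E × E → E := fun p ↦ p.2 + t • (p.1 - p.2)
  have hz : Measurable z := by fun_prop
  have hf : Measurable fun p : E × E ↦ (p.2, z p) := measurable_snd.prodMk hz
  have hg : Measurable fun p : E × E ↦ (p.1, z p) := measurable_fst.prodMk hz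
  refine ⟨π.map fun p ↦ (p.2, z p), Measure.isProbabilityMeasure_map hf.aemeasurable, ?_, ?_, ?_⟩
  · rw [Measure.fst_map_prodMk hz]
    exact hπ.2
  · rw [ae_map_iff hf.aemeasurable (measurableSet_le (by fun_prop) (by fun_prop))]
    filter_upwards [hnorm] with p hp
    simp only [z, add_sub_cancel_left, norm_smul, Real.norm_of_nonneg ht0]
    gcongr
  · refine wassersteinInfty_le_of_coupling (γ := π.map fun p ↦ (p.1, z p)) ⟨?_, ?_⟩ ?_
    · rw [Measure.fst_map_prodMk hz]
      exact hπ.1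
    · rw [Measure.snd_map_prodMk measurable_fst, Measure.snd_map_prodMk measurable_snd]
    · rw [ae_map_iff hg.aemeasurable (measurableSet_le (by fun_prop) (by fun_prop))]
      filter_upwards [hnorm] with p hp
      rw [edist_dist, dist_eq_norm]
      refine ENNReal.ofReal_le_ofReal ?_
      have : p.1 - z p = (1 - t) • (p.1 - p.2) := by
        simp only [z]
        module
      rw [this, norm_smul, Real.norm_of_nonneg (sub_nonneg.2 ht1)]
      exact mul_le_mul_of_nonneg_left hp (sub_nonneg.2 ht1)

/-- Splitting a squared displacement optimally between one step and the remaining ones. -/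
lemma shift_split_eq {a s w : ℝ} (ha : 0 < a) (hs : 0 < s) :
    ((1 + a * s)⁻¹ * w) ^ 2 + s⁻¹ * (Real.sqrt a⁻¹ * ((1 - (1 + a * s)⁻¹) * w)) ^ 2 =
      (1 + a * s)⁻¹ * w ^ 2 := by
  have : 0 < 1 + a * s := by positivity
  rw [mul_pow (Real.sqrt _), Real.sq_sqrt (by positivity)]
  field_simp
  ring

/-- Multi-step bound with slack: strict bounds on the Wasserstein distance are propagated with a
constant `L'` larger than the Lipschitz constant `L`. -/
theorem renyiDiv_bind_pow_le [StandardBorelSpace E] {q : ℝ≥0∞} (hq : 0 < q) {P : Kernel E E}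
    [IsMarkovKernel P] (hP : ∀ x y, P x ≪ P y) {c : ℝ} (hc : 0 < c)
    (h_reg : ∀ x y, renyiDiv q (P x) (P y) ≤ ((c * ‖x - y‖ ^ 2 : ℝ) : EReal))
    {L L' : ℝ} (hL : 0 < L) (hLL' : L < L')
    (h_lip : ∀ μ ν : Measure E, IsProbabilityMeasure μ → IsProbabilityMeasure ν →
      wassersteinInfty (μ.bind P) (ν.bind P) ≤ ENNReal.ofReal L * wassersteinInfty μ ν)
    {N : ℕ} (hN : 1 ≤ N) {μ μ' ν : Measure E} [IsProbabilityMeasure μ] [IsProbabilityMeasure μ']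
    [IsProbabilityMeasure ν] (hac : μ' ≪ ν) {B w : ℝ} (hB : renyiDiv q μ' ν ≤ (B : EReal))
    (hw : wassersteinInfty μ μ' < ENNReal.ofReal w) :
    renyiDiv q (μ.bind (P ^ N : Kernel E E)) (ν.bind (P ^ N : Kernel E E)) ≤
      ((B + c * ((∑ k ∈ Finset.range N, ((L' ^ 2)⁻¹) ^ k)⁻¹ * w ^ 2) : ℝ) : EReal) := by
  have hL' : 0 < L' := hL.trans hLL'
  have hreg' : ∀ {γ : Measure (E × E)} {r : ℝ}, (∀ᵐ p ∂γ, ‖p.2 - p.1‖ ≤ r) →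
      ∀ᵐ p ∂γ, renyiDiv q (P p.2) (P p.1) ≤ ((c * r ^ 2 : ℝ) : EReal) := by
    intro γ r h
    filter_upwards [h] with p hp
    refine (h_reg _ _).trans (EReal.coe_le_coe_iff.2 ?_)
    gcongr
  induction N, hN using Nat.le_induction generalizing μ μ' ν B w with
  | base =>
    have hw0 : 0 < w := ENNReal.ofReal_pos.1 (bot_le.trans_lt hw)
    obtain ⟨π, hπ, hdist⟩ := exists_coupling_of_wassersteinInfty_lt hw
    have := isProbabilityMeasure_of_mem_couplings hπ
    -- With one step left, the shift is complete (`t = 1`). The swap orients the coupling from `μ'`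
    -- to `μ`.
    have hfst : (π.map Prod.swap).fst = μ' := by rw [Measure.fst_map_swap, hπ.2]
    have hsnd : (π.map Prod.swap).snd = μ := by rw [Measure.snd_map_swap, hπ.1]
    have : IsProbabilityMeasure (π.map Prod.swap) :=
      Measure.isProbabilityMeasure_map measurable_swap.aemeasurable
    have hnorm : ∀ᵐ p ∂(π.map Prod.swap), ‖p.2 - p.1‖ ≤ w := by
      rw [ae_map_iff measurable_swap.aemeasurable (measurableSet_le (by fun_prop) (by fun_prop))]
      filter_upwards [hdist] with p hp
      rwa [edist_dist, ENNReal.ofReal_le_ofReal_iff hw0.le, dist_eq_norm] at hp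
    have key := renyiDiv_bind_le hq hP (hfst ▸ hac) (hfst ▸ hB) (hreg' hnorm)
    rw [hsnd] at key
    simpa using key
  | succ n hn ih =>
    have hw0 : 0 < w := ENNReal.ofReal_pos.1 (bot_le.trans_lt hw)
    set a : ℝ := (L' ^ 2)⁻¹ with ha_def
    set s : ℝ := ∑ k ∈ Finset.range n, a ^ k with hs_def
    have ha : 0 < a := by positivity
    have hs : 0 < s := Finset.sum_pos (fun _ _ ↦ by positivity) (by simpa using by omega)
    have hsum : ∑ k ∈ Finset.range (n + 1), a ^ k = 1 + a * s := by
      rw [geom_sum_succ, add_comm]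
    have hsqrt : Real.sqrt a⁻¹ = L' := by
      rw [ha_def, inv_inv, Real.sqrt_sq hL'.le]
    -- The minimizer of `t ^ 2 + (1 - t) ^ 2 / (a * s)`: the cost of this shift plus that of the
    -- remaining `n` steps, in units of `c * w ^ 2`.
    set t : ℝ := (1 + a * s)⁻¹ with ht_def
    have has : 0 < a * s := by positivity
    have ht0 : 0 < t := by positivity
    have ht1 : t < 1 := inv_lt_one_of_one_lt₀ (by linarith)
    obtain ⟨γ, hγ, hfst, hnorm, hW⟩ := exists_interpolating_coupling hw ht0.le ht1.le
    have key := renyiDiv_bind_le hq hP (hfst ▸ hac) (hfst ▸ hB) (hreg' hnorm)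
    have hW' : wassersteinInfty (μ.bind P) (γ.snd.bind P) <
        ENNReal.ofReal (L' * ((1 - t) * w)) := by
      refine (h_lip _ _ inferInstance inferInstance).trans_lt ?_
      have h1 : 0 < (1 - t) * w := mul_pos (by linarith) hw0
      calc ENNReal.ofReal L * wassersteinInfty μ γ.snd
          ≤ ENNReal.ofReal L * ENNReal.ofReal ((1 - t) * w) := by gcongr
        _ = ENNReal.ofReal (L * ((1 - t) * w)) := (ENNReal.ofReal_mul hL.le).symm
        -- Strictness, needed to pick a coupling at the next step, comes from `L < L'`.
        _ < _ := (ENNReal.ofReal_lt_ofReal_iff (by positivity)).2 (by gcongr)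
    have hfin := ih (absolutelyContinuous_bind hP γ.snd ν) key hW'
    have hbind : ∀ ρ : Measure E, (ρ.bind P).bind (P ^ n : Kernel E E) =
        ρ.bind (P ^ (n + 1) : Kernel E E) := fun ρ ↦ by
      rw [Measure.comp_assoc, pow_succ]
      rfl
    rw [hbind, hbind] at hfin
    refine hfin.trans (EReal.coe_le_coe_iff.2 (le_of_eq ?_))
    have := shift_split_eq (w := w) ha hs
    rw [hsqrt] at this
    rw [hsum, ← ht_def, ← this]
    ring

/-- The sum form treats `L = 1` uniformly and matches the limit as `L' → L`. -/
lemma multiStepFactor_eq_inv_sum {L : ℝ} (hL : 0 < L) (N : ℕ) :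
    multiStepFactor L N = (∑ k ∈ Finset.range N, ((L ^ 2)⁻¹) ^ k)⁻¹ := by
  unfold multiStepFactor
  split_ifs with h
  · simp [h]
  · have h1 : (L ^ 2)⁻¹ ≠ 1 := by
      simpa [pow_eq_one_iff_of_nonneg hL.le] using h
    rw [geom_sum_eq h1, inv_div, zpow_mul]
    simp [zpow_neg]

end Shifted

theorem theorem3p2 (d : ℕ) (q : ℝ≥0∞) (hq : 0 < q)
    (P : Kernel (EuclideanSpace ℝ (Fin d)) (EuclideanSpace ℝ (Fin d))) [IsMarkovKernel P]
    (c : ℝ) (hc : 0 < c)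
    (h_reg : ∀ x y : EuclideanSpace ℝ (Fin d),
      renyiDiv q (P x) (P y) ≤ ((c * ‖x - y‖ ^ 2 : ℝ) : EReal))
    (h_reg_one : q < 1 → ∃ c' : ℝ, ∀ x y : EuclideanSpace ℝ (Fin d),
      renyiDiv 1 (P x) (P y) ≤ ((c' * ‖x - y‖ ^ 2 : ℝ) : EReal))
    (L : ℝ) (hL : 0 < L)
    (h_lip : ∀ μ ν : Measure (EuclideanSpace ℝ (Fin d)),
      IsProbabilityMeasure μ → IsProbabilityMeasure ν →
      wassersteinInfty (μ.bind P) (ν.bind P) ≤ ENNReal.ofReal L * wassersteinInfty μ ν)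
    (N : ℕ) (hN : 1 ≤ N) (x y : EuclideanSpace ℝ (Fin d)) :
    renyiDiv q ((P ^ N) x) ((P ^ N) y) ≤
      ((c * multiStepFactor L N * ‖x - y‖ ^ 2 : ℝ) : EReal) := by
  have hP : ∀ x y, P x ≪ P y := by
    intro x y
    rcases lt_or_ge q 1 with h1 | h1
    · obtain ⟨c', hc'⟩ := h_reg_one h1
      exact absolutelyContinuous_of_renyiDiv_le le_rfl (hc' x y)
    · exact absolutelyContinuous_of_renyiDiv_le h1 (h_reg x y)
  have hbound : ∀ ε : ℝ, 0 < ε → renyiDiv q ((P ^ N) x) ((P ^ N) y) ≤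
      ((0 + c * ((∑ k ∈ Finset.range N, (((L + ε) ^ 2)⁻¹) ^ k)⁻¹ * (‖x - y‖ + ε) ^ 2) : ℝ) :
        EReal) := by
    intro ε hε
    have hw : wassersteinInfty (Measure.dirac x) (Measure.dirac y) <
        ENNReal.ofReal (‖x - y‖ + ε) := by
      refine (wassersteinInfty_dirac_le x y).trans_lt ?_
      rw [edist_dist, dist_eq_norm, ENNReal.ofReal_lt_ofReal_iff (by positivity)]
      linarith
    have := renyiDiv_bind_pow_le hq hP hc h_reg hL (lt_add_of_pos_right L hε) h_lip hN
      Measure.AbsolutelyContinuous.rfl (renyiDiv_self_le_zero q (Measure.dirac y)) hw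
    rwa [Measure.dirac_bind (Kernel.measurable _), Measure.dirac_bind (Kernel.measurable _)] at this
  -- Both slacks, in the Lipschitz constant and in the initial distance, are `ε`; let `ε → 0` from
  -- the right.
  have hcont : ContinuousAt (fun ε : ℝ ↦
      0 + c * ((∑ k ∈ Finset.range N, (((L + ε) ^ 2)⁻¹) ^ k)⁻¹ * (‖x - y‖ + ε) ^ 2)) 0 := by
    have hsum : ContinuousAt (fun ε : ℝ ↦ ∑ k ∈ Finset.range N, (((L + ε) ^ 2)⁻¹) ^ k) 0 := by
      refine tendsto_finsetSum _ fun k _ ↦ ContinuousAt.pow (ContinuousAt.inv₀ ?_ ?_) k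
      · fun_prop
      · simpa using hL.ne'
    have hpos : 0 < ∑ k ∈ Finset.range N, (((L + 0) ^ 2)⁻¹) ^ k :=
      Finset.sum_pos (fun _ _ ↦ by rw [add_zero]; positivity) (by simpa using by omega)
    exact continuousAt_const.add (continuousAt_const.mul
      ((hsum.inv₀ hpos.ne').mul (by fun_prop)))
  have hlim := (continuous_coe_real_ereal.continuousAt.comp hcont).tendsto.mono_left
    (nhdsWithin_le_nhds (s := Set.Ioi 0))
  have := ge_of_tendsto hlim (Filter.eventually_of_mem self_mem_nhdsWithin hbound)
  rw [multiStepFactor_eq_inv_sum hL, mul_assoc]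
  simpa using this
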